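/- Let $A$ be a finite alphabet, $e\notin A$ the empty letter, $\bar A=A\cup\{e\}$, and let $A^*$ be the set of strings on $A$, each string being regarded as a sequence $(x_j)_{j\ge 1}$ in $\bar A$ that consists of finitely many letters of $A$ followed by empty letters only; $o$ is the string without letters of $A$. Let $D$ be the set of distances $d:A^*\times A^*\to\mathbb N$, and let $d_{H'}\in D$ be the extended Hamming distance, $d_{H'}(s,t)=|\{j: x_j\neq y_j\}|$ for $s=(x_j)$, $t=(y_j)$. For $d\in D$, $\lambda\in A^*$, $\rho>0$ put $$q(s;\lambda,\rho)=\frac{1}{(\rho+1)\,|\partial U(\lambda,d(s,\lambda))|}\Big(\frac{\rho}{\rho+1}\Big)^{d(s,\lambda)},\qquad \partial U(\lambda,r)=\{t\in A^*: d(\lambda,t)=r\}$$ (with $1/\infty=0$; the same formula is used when $\rho=0$, with $0^0=1$). Let $\Theta=(0,1)^k\times(A^*)^k\times(0,\infty)^k$ and let $\theta^*=(\pi^*_g,\lambda^*_g,\rho^*_g)_{g=1}^k\in\Theta$ be the true parameter. Let $(\sigma_i,Z_i)$, $i\ge1$, be independent random elements of $A^*\times\{1,\dots,k\}$ with $P(Z_i=g)=\pi_g^*$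 and $P(Z_i=g,\sigma_i=s)=\pi^*_g\,q(s;\lambda^*_g,\rho^*_g)$; let $s_i$ be the observed value of $\sigma_i$ and, for $i\le n$, $$\zeta^*_{ig}=P(Z_i=g\mid\sigma_1=s_1,\dots,\sigma_n=s_n).$$ Given estimates $\hat\pi^{(n,t)}_g,\hat\lambda^{(n,t)}_g,\hat\rho^{(n,t)}_g$ ($n\ge 1$ the sample size, $t\ge0$ the iteration step), put for $t\ge1$ $$\hat\zeta^{(n,t)}_{ig}=\frac{\hat\pi^{(n,t-1)}_g\,q(s_i;\hat\lambda^{(n,t-1)}_g,\hat\rho^{(n,t-1)}_g)}{\sum_{g'=1}^k\hat\pi^{(n,t-1)}_{g'}\,q(s_i;\hat\lambda^{(n,t-1)}_{g'},\hat\rho^{(n,t-1)}_{g'})}.$$ Limits are taken as $n,t\to\infty$ jointly (almost surely the numbers $n_g$ of strings from the $g$-th subpopulation then all tend to infinity); the convergence of $\hat\zeta_{ig}$ is meant for each fixed $i$ and $g$, and "$\hat\lambda_g=\lambda_g^*$ eventually" means for all sufficiently large $n$ and $t$. Algorithm $H'$ with constant $\epsilon>0$ is the following iteration for $d=d_{H'}$.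 It starts from arbitrary initial values in $\Theta$ and, for $t=1,2,\dots$, computes $\hat\zeta_{ig}=\hat\zeta_{ig}^{(n,t,\epsilon)}$ by the formula above and then $$\hat\pi^{(n,t,\epsilon)}_g=\frac1n\sum_{i=1}^n\hat\zeta_{ig},\qquad \hat\rho^{(n,t,\epsilon)}_g=\frac{\sum_{i=1}^n\hat\zeta_{ig}\,d_{H'}(s_i,\hat\lambda_g^{(n,t,\epsilon)})}{\sum_{i=1}^n\hat\zeta_{ig}},$$ where $\hat\lambda_g^{(n,t,\epsilon)}$ is the truncated consensus sequence defined as follows. Let $\varphi_{gjx}=\sum_{i\le n:\,x_{ij}=x}\hat\zeta_{ig}\big/\sum_{i\le n}\hat\zeta_{ig}$ for $x\in\bar A$, where $x_{ij}$ is the $j$-th letter of $s_i$; let $j^*_g=\min\{j\ge1:\varphi_{gje}=\max_x\varphi_{gjx}\}-1$; let $U_g$ be the condition that some $j\in\{1,\dots,j_g^*\}$ satisfies $\max_{a\in A}\varphi_{gj'a}-\min_{a\in A}\varphi_{gj'a}<\epsilon$ for all $j'\in\{j,\dots,j_g^*\}$. The length of $\hat\lambda_g^{(n,t,\epsilon)}$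 is the least such $j$ minus $1$ if $U_g$ holds, and $j_g^*$ otherwise; its $j$-th letter is an arbitrary maximizer of $x\mapsto\varphi_{gjx}$ (length $0$ gives $o$). (a) Let $d\in D$ be arbitrary and let $\hat\pi_g^{(n,t)},\hat\lambda_g^{(n,t)},\hat\rho_g^{(n,t)}$ be any estimators. If for each $g$, as $n,t\to\infty$, almost surely $\hat\pi_g^{(n,t)}\to\pi^*_g$, $\hat\lambda^{(n,t)}_g=\lambda^*_g$ eventually, and $\hat\rho_g^{(n,t)}\to\rho_g^*$, then $\hat\zeta_{ig}^{(n,t)}-\zeta_{ig}^*\to0$ almost surely for each $i$ and $g$. (b) Conversely, let $d=d_{H'}$ and $|A|\ge2$. There is $\epsilon_0>0$, not depending on the outcome, the initial values or the choice of the maximizers, such that for any estimates produced by Algorithm $H'$ (for all $\epsilon>0$, with arbitrary, possibly data-dependent initial values) the following holds almost surely. For every $\epsilon\in(0,\epsilon_0]$: if $\hat\zeta^{(n,t,\epsilon)}_{ig}-\zeta^*_{ig}\to0$ as $n,t\to\infty$ for each $i$ and $g$, then for each $g$, as $n,t\to\infty$, $$\hat\pi_g^{(n,t,\epsilon)}\to\pi_g^*,\qquad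 \hat\lambda_g^{(n,t,\epsilon)}=\lambda_g^*\ \text{eventually},\qquad \hat\rho_g^{(n,t,\epsilon)}\to\rho_g^*.$$ In particular, if the $\hat\zeta^{(n,t,\epsilon)}_{ig}$ converge almost surely to $\zeta^*_{ig}$, then the estimates of Algorithm $H'$ are strongly consistent. -/

import Mathlib

open Filter Topology MeasureTheory ProbabilityTheory

/-- Strings on the alphabet `A` are lists. The sequence of letters of a string `s`, continued by empty
letters, is `j ↦ s[j]? : Option A`, where `none` is the empty letter `e`, so that `Option A` is the
extended alphabet. Sites are numbered from `0`. -/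
abbrev Str (A : Type*) := List A

/-- Distance functions on the set of strings with values in `ℕ`. -/
structure StrDist (A : Type*) where
  dist : Str A → Str A → ℕ
  dist_eq_zero_iff : ∀ s t, dist s t = 0 ↔ s = t
  dist_comm : ∀ s t, dist s t = dist t s
  dist_triangle : ∀ s t u, dist s u ≤ dist s t + dist t u

theorem finite_sites_ne {A : Type*} (s t : Str A) : {j : ℕ | s[j]? ≠ t[j]?}.Finite := by
  refine (Set.finite_lt_nat (max s.length t.length)).subset ?_
  intro j hj
  by_contra h
  simp only [Set.mem_ofPred_eq, not_lt, sup_le_iff] at h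
  exact hj (by rw [List.getElem?_eq_none h.1, List.getElem?_eq_none h.2])

/-- The extended Hamming distance: the number of sites (empty letters included) that have to be
substituted. -/
noncomputable def extHamming (A : Type*) : StrDist A where
  dist s t := {j : ℕ | s[j]? ≠ t[j]?}.ncard
  dist_eq_zero_iff s t := by
    rw [Set.ncard_eq_zero (finite_sites_ne s t)]
    constructor
    · intro h
      apply List.ext_getElem?
      intro j
      by_contra hj
      have : j ∈ {j : ℕ | s[j]? ≠ t[j]?} := hj
      rw [h] at this
      exact this
    · rintro rfl
      simp
  dist_comm s t := by
    congr 1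
    ext j
    exact ne_comm
  dist_triangle s t u := by
    refine le_trans (Set.ncard_le_ncard ?_ ((finite_sites_ne s t).union (finite_sites_ne t u)))
      (Set.ncard_union_le _ _)
    intro j hj
    by_contra h
    simp only [Set.mem_union, Set.mem_ofPred_eq, not_or, not_not] at h
    exact hj (h.1.trans h.2)

/-- The sphere `∂U_d(l, r)`. -/
def strSphere {A : Type*} (d : StrDist A) (l : Str A) (r : ℕ) : Set (Str A) :=
  {t | d.dist l t = r}

/-- The probability function `q_d(s; l, ρ)` of the Laplace-like distribution. If the sphere of `s` is
infinite, `Set.ncard` is `0` and the value is `0`, in accordance with `1 / ∞ = 0`. -/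
noncomputable def laplaceLike {A : Type*} (d : StrDist A) (l : Str A) (ρ : ℝ) (s : Str A) : ℝ :=
  1 / ((ρ + 1) * ((strSphere d l (d.dist s l)).ncard : ℝ)) * (ρ / (ρ + 1)) ^ d.dist s l

/-- Parameters `(π_g, λ_g, ρ_g)`, `g = 1, …, k`, of a mixture of `k` Laplace-like distributions. -/
structure MixParam (A : Type*) (k : ℕ) where
  weight : Fin k → ℝ
  loc : Fin k → Str A
  disp : Fin k → ℝ

/-- The parameter space `(0, 1)^k × (A^*)^k × (0, ∞)^k`. -/
def paramSpace (A : Type*) (k : ℕ) : Set (MixParam A k) :=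
  {θ | ∀ g, 0 < θ.weight g ∧ θ.weight g < 1 ∧ 0 < θ.disp g}

/-- The posterior weight `π_g q(s; λ_g, ρ_g) / ∑_{g'} π_{g'} q(s; λ_{g'}, ρ_{g'})`. -/
noncomputable def posteriorWeight {A : Type*} {k : ℕ} (d : StrDist A) (θ : MixParam A k) (s : Str A)
    (g : Fin k) : ℝ :=
  θ.weight g * laplaceLike d (θ.loc g) (θ.disp g) s /
    ∑ g' : Fin k, θ.weight g' * laplaceLike d (θ.loc g') (θ.disp g') s

/-- The estimated posterior weight of the string `s` at step `t ≥ 1`, computed from the parameter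
estimates of step `t - 1`. -/
noncomputable def zetaHat {A : Type*} {k : ℕ} (d : StrDist A) (θ : ℕ → MixParam A k) (t : ℕ)
    (s : Str A) (g : Fin k) : ℝ :=
  posteriorWeight d (θ (t - 1)) s g

/-- The sampling model: `σ i` is the `i`-th random string and `Z i` the latent label of the
subpopulation from which it is collected (the latent indicator vector is the `Z i`-th unit vector). -/
structure IsMixtureSample {A Ω : Type*} [MeasurableSpace Ω] {k : ℕ} (P : Measure Ω) (d : StrDist A)
    (θ : MixParam A k) (σ : ℕ → Ω → Str A) (Z : ℕ → Ω → Fin k) : Prop where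
  measurable : ∀ i, Measurable[_, ⊤] (fun ω => (σ i ω, Z i ω))
  indep : iIndepFun (m := fun _ => ⊤) (fun i ω => (σ i ω, Z i ω)) P
  law_label : ∀ i g, P.real {ω | Z i ω = g} = θ.weight g
  law : ∀ i g s, P.real {ω | Z i ω = g ∧ σ i ω = s} =
    θ.weight g * laplaceLike d (θ.loc g) (θ.disp g) s

/-- The true posterior weight `E[Z_{ig} | σ_1 = s_1, …, σ_n = s_n]` (the elementary conditional
probability that the label of the `i`-th string is `g`), where `s_1, …, s_n` is the sample observed at
the outcome `ω`. -/
noncomputable def truePosterior {A Ω : Type*} [MeasurableSpace Ω] {k : ℕ} (P : Measure Ω)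
    (σ : ℕ → Ω → Str A) (Z : ℕ → Ω → Fin k) (n i : ℕ) (g : Fin k) (ω : Ω) : ℝ :=
  (ProbabilityTheory.cond P {ω' | ∀ j < n, σ j ω' = σ j ω}).real {ω' | Z i ω' = g}

open Classical in
/-- The weighted relative frequency `φ_{jx}` of the letter `x` at site `j` of the strings
`s 0, …, s (n - 1)` with weights `w 0, …, w (n - 1)`. -/
noncomputable def weightedFreq {A : Type*} (n : ℕ) (s : ℕ → Str A) (w : ℕ → ℝ) (j : ℕ)
    (x : Option A) : ℝ :=
  1 / (∑ i ∈ Finset.range n, w i) * ∑ i ∈ Finset.range n with (s i)[j]? = x, w i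

/-- `j^*`: the first site (from `0`, hence the number of the sites before it) at which the empty letter
has maximal frequency. -/
noncomputable def jStar {A : Type*} (φ : ℕ → Option A → ℝ) : ℕ :=
  sInf {j | ∀ x, φ j x ≤ φ j none}

/-- From site `j` on and before site `j^*`, the frequencies of the nonempty letters are uniform up
to `ε`. -/
def UniformFrom {A : Type*} (φ : ℕ → Option A → ℝ) (ε : ℝ) (j : ℕ) : Prop :=
  j < jStar φ ∧ ∀ j', j ≤ j' → j' < jStar φ → (⨆ a : A, φ j' (some a)) - (⨅ a : A, φ j' (some a)) < ε

open Classical in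
/-- The length of a truncated consensus sequence: `j^{(ε)}` if condition `U^{(ε)}` holds, and `j^*`
otherwise. -/
noncomputable def truncLength {A : Type*} (φ : ℕ → Option A → ℝ) (ε : ℝ) : ℕ :=
  if ∃ j, UniformFrom φ ε j then sInf {j | UniformFrom φ ε j} else jStar φ

/-- `l` is a truncated consensus sequence for the frequencies `φ`: its letters are letters of maximal
frequency (an arbitrary one of them at each site). -/
def IsTruncatedConsensus {A : Type*} (φ : ℕ → Option A → ℝ) (ε : ℝ) (l : Str A) : Prop :=
  l.length = truncLength φ ε ∧ ∀ j < l.length, ∀ x, φ j x ≤ φ j l[j]?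

/-- `θ 0, θ 1, θ 2, …` are the successive parameter estimates of Algorithm `H'` (the iteration for
the extended Hamming distance that estimates the locations by truncated consensus sequences), with
constant `ε`, for the strings `s 0, …, s (n - 1)`. -/
structure IsAlgorithmHRun {A : Type*} {k : ℕ} (ε : ℝ) (n : ℕ) (s : ℕ → Str A)
    (θ : ℕ → MixParam A k) : Prop where
  init : θ 0 ∈ paramSpace A k
  weight_step : ∀ t, 1 ≤ t → ∀ g, (θ t).weight g =
    1 / (n : ℝ) * ∑ i ∈ Finset.range n, zetaHat (extHamming A) θ t (s i) g
  loc_step : ∀ t, 1 ≤ t → ∀ g, IsTruncatedConsensus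
    (weightedFreq n s (fun i => zetaHat (extHamming A) θ t (s i) g)) ε ((θ t).loc g)
  disp_step : ∀ t, 1 ≤ t → ∀ g, (θ t).disp g =
    1 / (∑ i ∈ Finset.range n, zetaHat (extHamming A) θ t (s i) g) *
      ∑ i ∈ Finset.range n, zetaHat (extHamming A) θ t (s i) g *
        ((extHamming A).dist (s i) ((θ t).loc g) : ℝ)

/-! By independence, the posterior of the `i`-th label given the whole sample depends on the `i`-th
string alone and is the posterior weight at the true parameter (`truePosterior_eq`). Part (a) is
then continuity of the posterior weight in weights and dispersions, the locations being eventually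
exact.

For (b), almost surely every string of positive mixture probability occurs in the sample, so the
hypothesis says that the estimated weights converge pointwise on the support of the mixture `p` to
the true posterior weights, and `p` times these is `π_g q_g`. A Scheffé argument
(`tendsto_mean_mul_of_tendsto`) upgrades this to convergence of weighted sample means to `π_g` times
means under `q_g`. The constant 1 gives the weights, indicators give the letter frequencies at each
site, and the distance to `λ_g` gives the dispersion, since this distance has mean `ρ_g`
(`hasSum_laplaceLike_mul_dist`).

The locations are read off from the limiting frequencies. Spheres grow with the radius if `|A| ≥ 2`,
so `q_g` strictly decreases with the distance. Injections that bring strings closer to `λ_g` show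
that its letter is the strict mode at each of its sites (`siteProb_lt_of_lt_length`); beyond its end
all nonempty letters are equally likely (`siteProb_some_eq_of_length_le`), and somewhere the empty
letter wins (`exists_siteProb_some_lt_none`). For `ε` below the gaps at the sites of `λ_g`,
truncation cuts exactly at the end of `λ_g` (`eq_of_separated`). -/

section Hamming

variable {A : Type*}

/-! ### Extended Hamming distance and the growth of its spheres -/

theorem extHamming_dist_eq (s t : Str A) :
    (extHamming A).dist s t = {j : ℕ | s[j]? ≠ t[j]?}.ncard := rfl

open Classical in
theorem extHamming_dist_cons (a b : A) (s t : Str A) :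
    (extHamming A).dist (a :: s) (b :: t) =
      (extHamming A).dist s t + if a = b then 0 else 1 := by
  have himg : (Nat.succ '' {j : ℕ | s[j]? ≠ t[j]?}).ncard = (extHamming A).dist s t :=
    Set.ncard_image_of_injective _ Nat.succ_injective
  have hfin : (Nat.succ '' {j : ℕ | s[j]? ≠ t[j]?}).Finite := (finite_sites_ne s t).image _
  rw [← himg, extHamming_dist_eq]
  split_ifs with h
  · rw [add_zero]
    congr 1
    ext j
    cases j <;> simp [h]
  · rw [← Set.ncard_insert_of_notMem (a := 0) (by simp) hfin]
    congr 1
    ext j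
    cases j <;> simp [h]

theorem extHamming_dist_nil_left (t : Str A) : (extHamming A).dist [] t = t.length := by
  have : {j : ℕ | ([] : Str A)[j]? ≠ t[j]?} = ↑(Finset.range t.length) := by
    ext j
    simp [eq_comm (a := none)]
  rw [extHamming_dist_eq, this, Set.ncard_coe_finset, Finset.card_range]

theorem extHamming_dist_nil_right (t : Str A) : (extHamming A).dist t [] = t.length := by
  rw [(extHamming A).dist_comm, extHamming_dist_nil_left]

theorem length_le_extHamming_dist_add (s l : Str A) :
    s.length ≤ (extHamming A).dist l s + l.length := by
  have := (extHamming A).dist_triangle s l []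
  rw [extHamming_dist_nil_right, extHamming_dist_nil_right, (extHamming A).dist_comm] at this
  exact this

theorem finite_strSphere_extHamming [Fintype A] (l : Str A) (r : ℕ) :
    (strSphere (extHamming A) l r).Finite := by
  refine (List.finite_length_le A (r + l.length)).subset fun s hs => ?_
  have := length_le_extHamming_dist_add s l
  rw [show (extHamming A).dist l s = r from hs] at this
  exact this

theorem ncard_strSphere_zero (d : StrDist A) (l : Str A) : (strSphere d l 0).ncard = 1 := by
  have : strSphere d l 0 = {l} := by
    ext t
    simp [strSphere, d.dist_eq_zero_iff, eq_comm]
  rw [this, Set.ncard_singleton]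

theorem ncard_strSphere_nil [Fintype A] (r : ℕ) :
    (strSphere (extHamming A) [] r).ncard = Fintype.card A ^ r := by
  have : strSphere (extHamming A) [] r = {t : List A | t.length = r} := by
    ext t
    simp [strSphere, extHamming_dist_nil_left]
  rw [this, ← card_vector (α := A) r, ← Nat.card_eq_fintype_card, ← Nat.card_coe_set_eq]
  rfl

-- Sort the sphere by first letter: `b` costs nothing, any other letter costs one, and the empty
-- string lies at distance `l.length + 1`, whence the last term.
open Classical in
theorem ncard_strSphere_cons [Fintype A] (b : A) (l : Str A) (r : ℕ) :
    (strSphere (extHamming A) (b :: l) (r + 1)).ncard =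
      (strSphere (extHamming A) l (r + 1)).ncard +
        (Fintype.card A - 1) * (strSphere (extHamming A) l r).ncard +
        if r = l.length then 1 else 0 := by
  set U : Set (Str A) := (fun t => b :: t) '' strSphere (extHamming A) l (r + 1) with hU
  set V : Set (Str A) := (fun p : A × Str A => p.1 :: p.2) ''
    ({c : A | c ≠ b} ×ˢ strSphere (extHamming A) l r) with hV
  set W : Set (Str A) := if r = l.length then {[]} else ∅ with hW
  have hdecomp : strSphere (extHamming A) (b :: l) (r + 1) = U ∪ V ∪ W := by
    ext t
    cases t with
    | nil =>
      by_cases h : r = l.length <;>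
        simp [hU, hV, hW, strSphere, extHamming_dist_nil_right, h, eq_comm]
    | cons c t =>
      by_cases hc : c = b
      · subst hc
        by_cases h : r = l.length <;> simp [hU, hV, hW, strSphere, extHamming_dist_cons, h]
      · by_cases h : r = l.length <;>
          simp [hU, hV, hW, strSphere, extHamming_dist_cons, h, hc, Ne.symm hc]
  have hUfin : U.Finite := (finite_strSphere_extHamming l (r + 1)).image _
  have hVfin : V.Finite := ((Set.toFinite _).prod (finite_strSphere_extHamming l r)).image _
  have hWfin : W.Finite := by rw [hW]; split_ifs <;> simp
  have hUV : Disjoint U V := by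
    rw [Set.disjoint_left]
    rintro _ ⟨t, -, rfl⟩ ⟨⟨c, t'⟩, ⟨hc, -⟩, h⟩
    simp only [List.cons.injEq] at h
    exact hc h.1
  have hUVW : Disjoint (U ∪ V) W := by
    rw [Set.disjoint_left]
    rintro t (⟨t, -, rfl⟩ | ⟨⟨c, t'⟩, -, rfl⟩) h <;> rw [hW] at h <;> split_ifs at h <;> simp at h
  rw [hdecomp, Set.ncard_union_eq hUVW (hUfin.union hVfin) hWfin,
    Set.ncard_union_eq hUV hUfin hVfin]
  congr 1
  · congr 1
    · exact Set.ncard_image_of_injective _ fun x y h => (List.cons.inj h).2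
    · rw [hV, Set.ncard_image_of_injective _ ?_, Set.ncard_prod]
      · congr 1
        have : {c : A | c ≠ b} = ↑(Finset.univ.erase b) := by ext; simp
        rw [this, Set.ncard_coe_finset, Finset.card_erase_of_mem (Finset.mem_univ _),
          Finset.card_univ]
      · rintro ⟨x, s⟩ ⟨y, t⟩ h
        simpa using h
  · rw [hW]
    split_ifs <;> simp

/-- Induction by the recursion above. From one radius to the next, its first two terms each gain at
least one, while the contribution of the empty string loses at most one. -/
theorem strictMono_ncard_strSphere_extHamming [Fintype A] (hA : 2 ≤ Fintype.card A) (l : Str A) :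
    StrictMono fun r => (strSphere (extHamming A) l r).ncard := by
  induction l with
  | nil =>
    simp only [ncard_strSphere_nil]
    exact pow_right_strictMono₀ (by omega)
  | cons b l ih =>
    refine strictMono_nat_of_lt_succ fun r => ?_
    obtain ⟨m, hm⟩ : ∃ m, Fintype.card A - 1 = m + 1 := ⟨Fintype.card A - 2, by omega⟩
    have h0 := ncard_strSphere_zero (extHamming A) l
    cases r with
    | zero =>
      have h1 := ih (show 0 < 1 by norm_num)
      simp only at h1
      simp only [ncard_strSphere_zero, ncard_strSphere_cons, hm]
      simp only [zero_add]
      split_ifs <;> omega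
    | succ r =>
      have h1 := ih (Nat.lt_succ_self r)
      have h2 := ih (Nat.lt_succ_self (r + 1))
      simp only [Nat.succ_eq_add_one] at h1 h2
      simp only [ncard_strSphere_cons, hm]
      have h3 : m * (strSphere (extHamming A) l r).ncard ≤
          m * (strSphere (extHamming A) l (r + 1)).ncard := Nat.mul_le_mul_left _ h1.le
      simp only [add_mul, one_mul]
      split_ifs <;> omega

theorem ncard_strSphere_extHamming_pos [Fintype A] (hA : 2 ≤ Fintype.card A) (l : Str A) (r : ℕ) :
    0 < (strSphere (extHamming A) l r).ncard := by
  have := (strictMono_ncard_strSphere_extHamming hA l).monotone (Nat.zero_le r)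
  simp only [ncard_strSphere_zero] at this
  omega

/-- A larger distance means a sphere at least as large and a strictly smaller geometric factor. -/
theorem laplaceLike_lt_of_dist_lt [Fintype A] (hA : 2 ≤ Fintype.card A) {l s t : Str A}
    {ρ : ℝ} (hρ : 0 < ρ)
    (h : (extHamming A).dist s l < (extHamming A).dist t l) :
    laplaceLike (extHamming A) l ρ t < laplaceLike (extHamming A) l ρ s := by
  unfold laplaceLike
  have h1 : (0 : ℝ) < (strSphere (extHamming A) l ((extHamming A).dist s l)).ncard := by
    exact_mod_cast ncard_strSphere_extHamming_pos hA l _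
  have h2 : ((strSphere (extHamming A) l ((extHamming A).dist s l)).ncard : ℝ) ≤
      (strSphere (extHamming A) l ((extHamming A).dist t l)).ncard := by
    exact_mod_cast (strictMono_ncard_strSphere_extHamming hA l).monotone h.le
  have hx1 : ρ / (ρ + 1) < 1 := (div_lt_one (by linarith)).2 (by linarith)
  apply mul_lt_mul'
  · gcongr
  · exact pow_lt_pow_right_of_lt_one₀ (by positivity) hx1 h
  · positivity
  · positivity

theorem laplaceLike_nonneg {d : StrDist A} {l : Str A} {ρ : ℝ} (hρ : 0 ≤ ρ) (s : Str A) :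
    0 ≤ laplaceLike d l ρ s := by
  unfold laplaceLike
  positivity

theorem laplaceLike_congr_dist {d : StrDist A} {l s t : Str A} {ρ : ℝ}
    (h : d.dist s l = d.dist t l) : laplaceLike d l ρ s = laplaceLike d l ρ t := by
  unfold laplaceLike
  rw [h]

end Hamming

/-! ### Letter probabilities at a site, and the mean distance, under a Laplace-like law -/

section SiteProb

variable {A : Type*}

theorem tsum_indicator_le_of_injOn {S : Type*} {q : S → ℝ} (hq0 : ∀ s, 0 ≤ q s) (hq : Summable q)
    {U V : Set S} (f : S → S) (hf : Set.InjOn f U) (hUV : Set.MapsTo f U V)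
    (hle : ∀ s ∈ U, q s ≤ q (f s)) :
    ∑' s, U.indicator q s ≤ ∑' s, V.indicator q s := by
  rw [← tsum_subtype, ← tsum_subtype]
  exact Summable.tsum_le_tsum_of_inj (hUV.restrict f U V) (hUV.restrict_inj.2 hf)
    (fun c _ => hq0 c) (fun s => hle s s.2) (hq.subtype U) (hq.subtype V)

theorem tsum_indicator_lt_of_injOn {S : Type*} {q : S → ℝ} (hq0 : ∀ s, 0 ≤ q s) (hq : Summable q)
    {U V : Set S} (f : S → S) (hf : Set.InjOn f U) (hUV : Set.MapsTo f U V)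
    (hlt : ∀ s ∈ U, q s < q (f s)) (hU : U.Nonempty) :
    ∑' s, U.indicator q s < ∑' s, V.indicator q s := by
  rw [← tsum_subtype, ← tsum_subtype]
  obtain ⟨u, hu⟩ := hU
  have hinj := hUV.restrict_inj.2 hf
  have hs : Summable fun u : U => q (f u) :=
    (hq.subtype V).comp_injective hinj
  calc ∑' u : U, q u < ∑' u : U, q (f u) :=
        Summable.tsum_lt_tsum (i := ⟨u, hu⟩) (fun s => (hlt s s.2).le) (hlt u hu) (hq.subtype U) hs
    _ ≤ ∑' v : V, q v := Summable.tsum_le_tsum_of_inj (hUV.restrict f U V) hinj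
        (fun c _ => hq0 c) (fun _ => le_rfl) hs (hq.subtype V)

/-- The probability of the letter `x` at site `j` under the probability function `q`. -/
noncomputable def siteProb (q : Str A → ℝ) (j : ℕ) (x : Option A) : ℝ :=
  ∑' s, {s : Str A | s[j]? = x}.indicator q s

theorem injOn_set_site (j : ℕ) (a b : A) :
    Set.InjOn (fun s : Str A => s.set j b) {s | s[j]? = some a} := by
  intro s hs t ht h
  apply List.ext_getElem?
  intro i
  have hi := congrArg (fun u : Str A => u[i]?) h
  simp only [List.getElem?_set] at hi
  by_cases hij : j = i
  · subst hij
    rw [Set.mem_ofPred_eq] at hs ht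
    rw [hs, ht]
  · simpa [hij] using hi

theorem mapsTo_set_site (j : ℕ) (a b : A) :
    Set.MapsTo (fun s : Str A => s.set j b) {s | s[j]? = some a} {s | s[j]? = some b} := by
  intro s hs
  have : j < s.length := (List.getElem?_eq_some_iff.1 hs).1
  simp [this]

theorem extHamming_dist_set_lt {s l : Str A} {j : ℕ} {a b : A} (hs : s[j]? = some a)
    (hl : l[j]? = some b) (hab : a ≠ b) :
    (extHamming A).dist (s.set j b) l < (extHamming A).dist s l := by
  have hj : j < s.length := (List.getElem?_eq_some_iff.1 hs).1
  apply Set.ncard_lt_ncard _ (finite_sites_ne s l)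
  refine Set.ssubset_iff_subset_ne.2 ⟨fun i hi => ?_, fun h => ?_⟩
  · by_cases hij : j = i
    · subst hij
      simp [hj, hl] at hi
    · simpa [List.getElem?_set, hij] using hi
  · have hjm : j ∈ {i : ℕ | s[i]? ≠ l[i]?} := by simp [hs, hl, hab]
    rw [← h] at hjm
    simp [hj, hl] at hjm

theorem extHamming_dist_set_eq {s l : Str A} {j : ℕ} {a : A} (b : A) (hs : s[j]? = some a)
    (hl : l.length ≤ j) :
    (extHamming A).dist (s.set j b) l = (extHamming A).dist s l := by
  have hj : j < s.length := (List.getElem?_eq_some_iff.1 hs).1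
  rw [extHamming_dist_eq, extHamming_dist_eq]
  congr 1
  ext i
  by_cases hij : j = i
  · subst hij
    simp [hj, hl]
  · simp [List.getElem?_set, hij]

/-- Complete the string `s` by the letters of `l` up to the site `j`, and append as many further
letters `a` as are needed to recover the length of `s`. -/
def completeTo (l : Str A) (j : ℕ) (a : A) (s : Str A) : Str A :=
  s ++ (l.take (j + 1)).drop s.length ++ List.replicate (j - s.length) a

theorem length_completeTo {l s : Str A} {j : ℕ} {a : A} (hj : j < l.length) (hs : s.length ≤ j) :
    (completeTo l j a s).length = j + 1 + (j - s.length) := by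
  simp only [completeTo, List.length_append, List.length_drop, List.length_take,
    List.length_replicate]
  omega

theorem getElem?_completeTo {l s : Str A} {j i : ℕ} {a : A} (hj : j < l.length)
    (hs : s.length ≤ j) :
    (completeTo l j a s)[i]? = if i < s.length then s[i]? else if i ≤ j then l[i]? else
      if i < j + 1 + (j - s.length) then some a else none := by
  have hlen : (s ++ (l.take (j + 1)).drop s.length).length = j + 1 := by
    simp only [List.length_append, List.length_drop, List.length_take]
    omega
  unfold completeTo
  rw [List.getElem?_append, hlen]
  split_ifs with h1 h2 h3 h4 h5 h6 h7
  · rw [List.getElem?_append_left h2]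
  · rw [List.getElem?_append_right (by omega), List.getElem?_drop,
      List.getElem?_take_of_lt (by omega)]
    congr 1
    omega
  · omega
  · omega
  · omega
  · omega
  · rw [List.getElem?_replicate, if_pos (by omega)]
  · rw [List.getElem?_replicate, if_neg (by omega)]

/-- The completed string has length `2j + 1 - s.length`, so `s` is recovered as its prefix of the
right length. Without the padding, different prefixes of `l` would be completed to the same string.
-/
theorem injOn_completeTo {l : Str A} {j : ℕ} (a : A) (hj : j < l.length) :
    Set.InjOn (completeTo l j a) {s | s.length ≤ j} := by
  intro s hs t ht h
  have hlen := congrArg List.length h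
  rw [Set.mem_ofPred_eq] at hs ht
  rw [length_completeTo hj hs, length_completeTo hj ht] at hlen
  have : s.length = t.length := by omega
  unfold completeTo at h
  rw [List.append_assoc, List.append_assoc] at h
  exact (List.append_inj h this).1

/-- Filling in repairs `j + 1 - s.length` sites, and the padding spoils at most `j - s.length`: a
net gain of at least one. -/
theorem extHamming_dist_completeTo_lt {l s : Str A} {j : ℕ} (a : A) (hj : j < l.length)
    (hs : s.length ≤ j) :
    (extHamming A).dist (completeTo l j a s) l < (extHamming A).dist s l := by
  set M : Set ℕ := {i | s[i]? ≠ l[i]?} with hM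
  have hMfin : M.Finite := finite_sites_ne s l
  -- `I` consists of the repaired sites and `K` of the padded ones.
  set I : Finset ℕ := Finset.Ico s.length (j + 1)
  set K : Finset ℕ := Finset.Ico (j + 1) (j + 1 + (j - s.length))
  have hIM : (I : Set ℕ) ⊆ M := by
    intro i hi
    simp only [I, Finset.coe_Ico, Set.mem_Ico] at hi
    have h1 : s[i]? = none := List.getElem?_eq_none hi.1
    have h2 : l[i]? = some (l[i]'(by omega)) := List.getElem?_eq_getElem (by omega)
    simp only [hM, Set.mem_ofPred_eq, h1, h2]
    simp
  have hsub : {i | (completeTo l j a s)[i]? ≠ l[i]?} ⊆ (M \ I) ∪ K := by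
    intro i hi
    rw [Set.mem_ofPred_eq, getElem?_completeTo hj hs] at hi
    simp only [hM, I, K, Finset.coe_Ico, Set.mem_union, Set.mem_sdiff, Set.mem_ofPred_eq,
      Set.mem_Ico]
    split_ifs at hi with h1 h2 h3
    · exact Or.inl ⟨hi, by omega⟩
    · exact absurd rfl hi
    · exact Or.inr (by omega)
    · refine Or.inl ⟨?_, by omega⟩
      rwa [List.getElem?_eq_none (by omega)]
  have h1 : (extHamming A).dist (completeTo l j a s) l ≤ (M \ I).ncard + (K : Set ℕ).ncard :=
    (Set.ncard_le_ncard hsub (hMfin.sdiff.union K.finite_toSet)).trans (Set.ncard_union_le _ _)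
  have h2 : (M \ I).ncard + (I : Set ℕ).ncard = M.ncard :=
    Set.ncard_sdiff_add_ncard_of_subset hIM hMfin
  have h3 : (extHamming A).dist s l = M.ncard := rfl
  rw [Set.ncard_coe_finset, Nat.card_Ico] at h1 h2
  omega

theorem siteProb_lt_of_lt_length [Fintype A] (hA : 2 ≤ Fintype.card A) {l : Str A}
    {ρ : ℝ} (hρ : 0 < ρ)
    (hq : Summable (laplaceLike (extHamming A) l ρ)) {j : ℕ} (hj : j < l.length) {x : Option A}
    (hx : x ≠ l[j]?) :
    siteProb (laplaceLike (extHamming A) l ρ) j x <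
      siteProb (laplaceLike (extHamming A) l ρ) j l[j]? := by
  have hlj : l[j]? = some l[j] := List.getElem?_eq_getElem hj
  have hq0 := fun s => laplaceLike_nonneg (d := extHamming A) (l := l) hρ.le s
  rw [hlj] at hx ⊢
  cases x with
  | none =>
    refine tsum_indicator_lt_of_injOn hq0 hq (completeTo l j l[j]) ?_ ?_ ?_ ⟨[], by simp⟩
    · exact (injOn_completeTo l[j] hj).mono fun s hs => List.getElem?_eq_none_iff.1 hs
    · intro s hs
      have hs : s.length ≤ j := List.getElem?_eq_none_iff.1 hs
      rw [Set.mem_ofPred_eq, getElem?_completeTo hj hs, if_neg (by omega), if_pos le_rfl, hlj]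
    · intro s hs
      exact laplaceLike_lt_of_dist_lt hA hρ
        (extHamming_dist_completeTo_lt l[j] hj (List.getElem?_eq_none_iff.1 hs))
  | some a =>
    refine tsum_indicator_lt_of_injOn hq0 hq (fun s => s.set j l[j]) (injOn_set_site j a _)
      (mapsTo_set_site j a _) ?_ ⟨l.set j a, by simp [hj]⟩
    intro s hs
    exact laplaceLike_lt_of_dist_lt hA hρ (extHamming_dist_set_lt hs hlj fun h => hx (by rw [h]))

/-- Any nonempty letter beyond the end of `l` is a mismatch, so exchanging it for another one keeps
the distance. -/
theorem siteProb_some_eq_of_length_le [Fintype A] {l : Str A} {ρ : ℝ} (hρ : 0 < ρ)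
    (hq : Summable (laplaceLike (extHamming A) l ρ)) {j : ℕ} (hj : l.length ≤ j) (a b : A) :
    siteProb (laplaceLike (extHamming A) l ρ) j (some a) =
      siteProb (laplaceLike (extHamming A) l ρ) j (some b) := by
  have key : ∀ a b : A, siteProb (laplaceLike (extHamming A) l ρ) j (some a) ≤
      siteProb (laplaceLike (extHamming A) l ρ) j (some b) := fun a b =>
    tsum_indicator_le_of_injOn (laplaceLike_nonneg hρ.le) hq (fun s => s.set j b)
      (injOn_set_site j a b) (mapsTo_set_site j a b)
      fun s hs => (laplaceLike_congr_dist (extHamming_dist_set_eq b hs hj)).ge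
  exact le_antisymm (key a b) (key b a)

theorem exists_siteProb_some_lt_none {q : Str A → ℝ} (hq0 : ∀ s, 0 ≤ q s) (hq : HasSum q 1) :
    ∃ j, ∀ a, siteProb q j (some a) < siteProb q j none := by
  obtain ⟨F, hF⟩ := (hq.eventually (lt_mem_nhds (show (1 / 2 : ℝ) < 1 by norm_num))).exists
  -- `F` carries more than half of the mass, and all its strings have ended before this site.
  refine ⟨F.sup List.length, fun a => ?_⟩
  set j := F.sup List.length
  have hsum : ∀ U : Set (Str A), Summable (U.indicator q) := fun U => hq.summable.indicator U
  have h1 : (1 / 2 : ℝ) < siteProb q j none := by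
    refine hF.trans_le ?_
    have : ∑ s ∈ F, q s = ∑ s ∈ F, {s : Str A | s[j]? = none}.indicator q s := by
      refine Finset.sum_congr rfl fun s hs => ?_
      rw [Set.indicator_of_mem]
      exact List.getElem?_eq_none (Finset.le_sup (f := List.length) hs)
    rw [this]
    exact (hsum _).sum_le_tsum _ fun s _ => Set.indicator_nonneg (fun s _ => hq0 s) s
  have h2 : siteProb q j (some a) + siteProb q j none ≤ 1 := by
    unfold siteProb
    rw [← (hsum _).tsum_add (hsum _), ← hq.tsum_eq]
    refine ((hsum _).add (hsum _)).tsum_le_tsum (fun s => ?_) hq.summable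
    simp only [Set.indicator, Set.mem_ofPred_eq]
    have := hq0 s
    split_ifs with h h' <;> simp_all
  linarith

/-- The mass of a sphere is spread evenly over its points, so the cardinalities cancel: the distance
has a geometric law with ratio `ρ / (ρ + 1)`, whose mean is `ρ`. -/
theorem hasSum_laplaceLike_mul_dist [Fintype A] (hA : 2 ≤ Fintype.card A) (l : Str A)
    {ρ : ℝ} (hρ : 0 < ρ) :
    HasSum (fun s => laplaceLike (extHamming A) l ρ s * ((extHamming A).dist s l : ℝ)) ρ := by
  set f : Str A → ℝ := fun s => laplaceLike (extHamming A) l ρ s * ((extHamming A).dist s l : ℝ)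
  set x : ℝ := ρ / (ρ + 1) with hx
  have hx0 : 0 ≤ x := by positivity
  have hx1 : x < 1 := (div_lt_one (by linarith)).2 (by linarith)
  have hgeom : HasSum (fun r : ℕ => 1 / (ρ + 1) * (r * x ^ r)) ρ := by
    have := (hasSum_coe_mul_geometric_of_norm_lt_one
      (by rwa [Real.norm_of_nonneg hx0] : ‖x‖ < 1)).mul_left (1 / (ρ + 1))
    have h1x : (1 : ℝ) - x = 1 / (ρ + 1) := by rw [hx]; field_simp; ring
    have hval : 1 / (ρ + 1) * (x / (1 - x) ^ 2) = ρ := by rw [h1x, hx]; field_simp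
    rwa [hval] at this
  have hfiber : ∀ r : ℕ, HasSum (fun s : {s // (extHamming A).dist s l = r} => f s)
      (1 / (ρ + 1) * (r * x ^ r)) := by
    intro r
    have hset : {s | (extHamming A).dist s l = r} = strSphere (extHamming A) l r := by
      ext s
      simp [strSphere, (extHamming A).dist_comm s l]
    have hfin : {s | (extHamming A).dist s l = r}.Finite := hset ▸ finite_strSphere_extHamming l r
    have : Fintype {s // (extHamming A).dist s l = r} := hfin.fintype
    have hcard : (Fintype.card {s // (extHamming A).dist s l = r} : ℝ) =
        (strSphere (extHamming A) l r).ncard := by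
      rw [← hset, ← Nat.card_coe_set_eq, ← Nat.card_eq_fintype_card]
      rfl
    have hpos : (0 : ℝ) < (strSphere (extHamming A) l r).ncard := by
      exact_mod_cast ncard_strSphere_extHamming_pos hA l r
    convert hasSum_fintype (fun s : {s // (extHamming A).dist s l = r} => f s) using 1
    rw [Finset.sum_congr rfl (g := fun _ => 1 / ((ρ + 1) *
      ((strSphere (extHamming A) l r).ncard : ℝ)) * x ^ r * r)
      (fun s _ => by simp only [f, laplaceLike, s.2, hx]), Finset.sum_const, Finset.card_univ,
      nsmul_eq_mul, hcard]
    field_simp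
  have hf0 : ∀ s, 0 ≤ f s := fun s => mul_nonneg (laplaceLike_nonneg hρ.le s) (Nat.cast_nonneg _)
  set e := Equiv.sigmaFiberEquiv fun s : Str A => (extHamming A).dist s l
  rw [← e.hasSum_iff]
  have hsum : Summable (f ∘ e) := by
    refine (summable_sigma_of_nonneg fun _ => hf0 _).2 ⟨fun r => (hfiber r).summable, ?_⟩
    exact hgeom.summable.congr fun r => (hfiber r).tsum_eq.symm
  exact (hsum.hasSum.sigma hfiber).unique hgeom ▸ hsum.hasSum

end SiteProb

/-! ### Recovery of a string by the truncated consensus -/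

section Consensus

variable {A : Type*} [Finite A]

/-- The empty letter is not maximal at the sites of `l`, so `jStar φ` is at least `l.length`. A
uniform stretch cannot begin earlier, because it would include the last site of `l`, where the gap
exceeds `ε`; it does begin at `l.length` if `jStar φ` is larger. -/
theorem IsTruncatedConsensus.eq_of_separated [Nonempty A] {φ : ℕ → Option A → ℝ} {ε : ℝ}
    {l lh : Str A} {J : ℕ} (hmax : ∀ j < l.length, ∀ x, x ≠ l[j]? → φ j x < φ j l[j]?)
    (hJ : ∀ a, φ J (some a) ≤ φ J none)
    (hunif : ∀ j < J, l.length ≤ j → ∀ a b, φ j (some a) - φ j (some b) < ε)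
    (hgap : ∀ j < l.length, ∃ a b, ε < φ j (some a) - φ j (some b))
    (h : IsTruncatedConsensus φ ε lh) : lh = l := by
  have hJmem : J ∈ {j | ∀ x, φ j x ≤ φ j none} := by
    rintro (_ | a)
    · exact le_rfl
    · exact hJ a
  -- The site `J` makes the set nonempty, so the infimum is attained and is not the default 0.
  have hstar : ∀ x, φ (jStar φ) x ≤ φ (jStar φ) none := Nat.sInf_mem ⟨J, hJmem⟩
  have hstarJ : jStar φ ≤ J := Nat.sInf_le hJmem
  have hLstar : l.length ≤ jStar φ := by
    by_contra hlt
    rw [not_le] at hlt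
    refine absurd (hmax _ hlt none ?_) (not_lt.2 (hstar _))
    simp [List.getElem?_eq_getElem hlt]
  have hU : ∀ j, UniformFrom φ ε j → l.length ≤ j := by
    rintro j ⟨hj, hju⟩
    by_contra hlt
    obtain ⟨a, b, hab⟩ := hgap (l.length - 1) (by omega)
    have h1 := hju (l.length - 1) (by omega) (by omega)
    have h2 := le_ciSup (Set.finite_range fun a : A => φ (l.length - 1) (some a)).bddAbove a
    have h3 := ciInf_le (Set.finite_range fun a : A => φ (l.length - 1) (some a)).bddBelow b
    linarith
  have hUL : l.length < jStar φ → UniformFrom φ ε l.length := by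
    refine fun hlt => ⟨hlt, fun j hj hj' => ?_⟩
    obtain ⟨a, ha⟩ := exists_eq_ciSup_of_finite (f := fun a : A => φ j (some a))
    obtain ⟨b, hb⟩ := exists_eq_ciInf_of_finite (f := fun a : A => φ j (some a))
    rw [← ha, ← hb]
    exact hunif j (by omega) hj a b
  have hlen : lh.length = l.length := by
    rw [h.1, truncLength]
    split_ifs with hex
    · obtain ⟨j, hj⟩ := hex
      exact le_antisymm (Nat.sInf_le (hUL ((hU j hj).trans_lt hj.1)))
        (le_csInf ⟨j, hj⟩ fun i hi => hU i hi)
    · by_contra hne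
      exact hex ⟨_, hUL (by omega)⟩
  apply List.ext_getElem?
  intro j
  rcases lt_or_ge j l.length with hj | hj
  · by_contra hne
    exact absurd (hmax j hj _ hne) (not_lt.2 (h.2 j (by omega) _))
  · rw [List.getElem?_eq_none hj, List.getElem?_eq_none (by omega)]

theorem eventually_eq_of_isTruncatedConsensus [Nonempty A] {ι : Type*} {F : Filter ι} {l : Str A}
    {φ : ℕ → Option A → ℝ} {φh : ι → ℕ → Option A → ℝ} {lh : ι → Str A} {ε : ℝ} (hε : 0 < ε)
    (hφ : ∀ j x, Tendsto (fun i => φh i j x) F (𝓝 (φ j x)))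
    (hmax : ∀ j < l.length, ∀ x, x ≠ l[j]? → φ j x < φ j l[j]?)
    (hunif : ∀ j, l.length ≤ j → ∀ a b, φ j (some a) = φ j (some b))
    (hnone : ∃ J, ∀ a, φ J (some a) < φ J none)
    (hgap : ∀ j < l.length, ∃ a b, ε < φ j (some a) - φ j (some b))
    (h : ∀ᶠ i in F, IsTruncatedConsensus (φh i) ε (lh i)) : ∀ᶠ i in F, lh i = l := by
  obtain ⟨J, hJ⟩ := hnone
  -- Only sites up to `J` or within `l` matter: finitely many strict inequalities, each inherited
  -- from the limit.
  have e1 : ∀ᶠ i in F, ∀ j ∈ {j | j < l.length}, ∀ x, x ≠ l[j]? → φh i j x < φh i j l[j]? := by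
    rw [eventually_all_finite (Set.finite_lt_nat _)]
    refine fun j hj => eventually_all.2 fun x => ?_
    by_cases hx : x = l[j]?
    · exact Eventually.of_forall fun _ h => absurd hx h
    · exact ((hφ j x).eventually_lt (hφ j _) (hmax j hj x hx)).mono fun _ h _ => h
  have e2 : ∀ᶠ i in F, ∀ a, φh i J (some a) < φh i J none :=
    eventually_all.2 fun a => (hφ J _).eventually_lt (hφ J _) (hJ a)
  have e3 : ∀ᶠ i in F, ∀ j ∈ {j | j < J}, l.length ≤ j →
      ∀ a b, φh i j (some a) - φh i j (some b) < ε := by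
    rw [eventually_all_finite (Set.finite_lt_nat _)]
    refine fun j _ => ?_
    by_cases hj : l.length ≤ j
    · have : ∀ᶠ i in F, ∀ a b, φh i j (some a) - φh i j (some b) < ε := by
        refine eventually_all.2 fun a => eventually_all.2 fun b => ?_
        exact ((hφ j (some a)).sub (hφ j (some b))).eventually_lt_const
          (by rw [hunif j hj a b, sub_self]; exact hε)
      exact this.mono fun _ h _ => h
    · exact Eventually.of_forall fun _ h => absurd h hj
  have e4 : ∀ᶠ i in F, ∀ j ∈ {j | j < l.length}, ∃ a b,
      ε < φh i j (some a) - φh i j (some b) := by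
    rw [eventually_all_finite (Set.finite_lt_nat _)]
    intro j hj
    obtain ⟨a, b, hab⟩ := hgap j hj
    exact (((hφ j (some a)).sub (hφ j (some b))).eventually_const_lt hab).mono
      fun _ h => ⟨a, b, h⟩
  filter_upwards [e1, e2, e3, e4, h] with i h1 h2 h3 h4 h5
  exact h5.eq_of_separated h1 (fun a => (h2 a).le) h3 h4

end Consensus

/-! ### Sample means under converging weights -/

section Mean

theorem hasSum_empirical {S : Type*} [DecidableEq S] (s : ℕ → S) (n : ℕ) (G : S → ℝ) :
    HasSum (fun x => (∑ i ∈ Finset.range n, if s i = x then (1 : ℝ) else 0) / n * G x)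
      ((∑ i ∈ Finset.range n, G (s i)) / n) := by
  have : HasSum (fun x => ∑ i ∈ Finset.range n, if x = s i then G (s i) else 0)
      (∑ i ∈ Finset.range n, G (s i)) := hasSum_sum fun i _ => hasSum_ite_eq (s i) (G (s i))
  refine (this.div_const (n : ℝ)).congr_fun fun x => ?_
  rw [div_mul_eq_mul_div, Finset.sum_mul]
  congr 1
  refine Finset.sum_congr rfl fun i _ => ?_
  by_cases h : s i = x
  · simp [h]
  · simp [h, Ne.symm h]

/-- If the relative frequencies in a sequence converge to `p` and the means of `h ≥ 0` converge to
the `p`-mean of `h`, then this convergence persists under weights in `[0, 1]` that converge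
pointwise. -/
theorem tendsto_mean_mul_of_tendsto {S ι : Type*} [DecidableEq S] {s : ℕ → S} {p h : S → ℝ} (hp : ∀ x, 0 ≤ p x)
    (hh : ∀ x, 0 ≤ h x) (hsum : Summable fun x => p x * h x)
    (hfreq : ∀ x, Tendsto
      (fun n : ℕ => (∑ i ∈ Finset.range n, if s i = x then (1 : ℝ) else 0) / n) atTop (𝓝 (p x)))
    (hmean : Tendsto (fun n : ℕ => (∑ i ∈ Finset.range n, h (s i)) / n) atTop
      (𝓝 (∑' x, p x * h x)))
    {F : Filter ι} {N : ι → ℕ} (hN : Tendsto N F atTop) {w : ι → S → ℝ} {v : S → ℝ}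
    (hw : ∀ᶠ i in F, ∀ x, 0 ≤ w i x ∧ w i x ≤ 1)
    (hv : ∀ x, p x ≠ 0 → Tendsto (fun i => w i x) F (𝓝 (v x))) :
    Tendsto (fun i => (∑ m ∈ Finset.range (N i), w i (s m) * h (s m)) / N i) F
      (𝓝 (∑' x, p x * h x * v x)) := by
  set f : ℕ → S → ℝ := fun n x => (∑ i ∈ Finset.range n, if s i = x then (1 : ℝ) else 0) / n
  have hf0 : ∀ n x, 0 ≤ f n x := fun n x =>
    div_nonneg (Finset.sum_nonneg fun i _ => by split_ifs <;> simp) (Nat.cast_nonneg n)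
  have hph : ∀ x, 0 ≤ p x * h x := fun x => mul_nonneg (hp x) (hh x)
  have hbnd : ∀ n x, ‖max (p x - f n x) 0 * h x‖ ≤ p x * h x := by
    intro n x
    rw [Real.norm_of_nonneg (mul_nonneg (le_max_right _ _) (hh x))]
    exact mul_le_mul_of_nonneg_right (max_le (by linarith [hf0 n x]) (hp x)) (hh x)
  -- The empirical frequencies have no summable majorant in general, but the positive part of `p - f
  -- n` is dominated by `p`.
  have hpart : Tendsto (fun n => ∑' x, max (p x - f n x) 0 * h x) atTop (𝓝 0) := by
    have := tendsto_tsum_of_dominated_convergence (𝓕 := atTop)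
      (f := fun n x => max (p x - f n x) 0 * h x) (g := fun _ => (0 : ℝ)) hsum
      (fun x => ?_) (Eventually.of_forall hbnd)
    · simpa using this
    · have h1 := ((tendsto_const_nhds (x := p x)).sub (hfreq x)).max
        (tendsto_const_nhds (x := (0 : ℝ)))
      rw [sub_self, max_self] at h1
      simpa only [zero_mul] using h1.mul_const (h x)
  -- Scheffé's identity `|f - p| = (f - p) + 2 (p - f)⁺`, summed against `h`.
  have hdist : ∀ n, HasSum (fun x => |f n x - p x| * h x)
      ((∑ i ∈ Finset.range n, h (s i)) / n - ∑' x, p x * h x +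
        2 * ∑' x, max (p x - f n x) 0 * h x) := by
    intro n
    have hs : Summable fun x => max (p x - f n x) 0 * h x := .of_norm_bounded hsum (hbnd n)
    refine (((hasSum_empirical s n h).sub hsum.hasSum).add (hs.hasSum.mul_left 2)).congr_fun ?_
    intro x
    change |f n x - p x| * h x = f n x * h x - p x * h x + 2 * (max (p x - f n x) 0 * h x)
    rcases le_total (p x) (f n x) with hle | hle
    · rw [max_eq_right (by linarith), abs_of_nonneg (by linarith)]
      ring
    · rw [max_eq_left (by linarith), abs_of_nonpos (by linarith)]
      ring
  have hdist0 : Tendsto (fun n => ∑' x, |f n x - p x| * h x) atTop (𝓝 0) := by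
    have := (hmean.sub (tendsto_const_nhds (x := ∑' x, p x * h x))).add (hpart.const_mul 2)
    simpa using this.congr fun n => (hdist n).tsum_eq.symm
  have hwp : Tendsto (fun i => ∑' x, p x * h x * w i x) F (𝓝 (∑' x, p x * h x * v x)) := by
    refine tendsto_tsum_of_dominated_convergence hsum (fun x => ?_) ?_
    · by_cases hpx : p x = 0
      · simpa [hpx] using tendsto_const_nhds
      · exact (hv x hpx).const_mul _
    · filter_upwards [hw] with i hi x
      rw [Real.norm_of_nonneg (mul_nonneg (hph x) (hi x).1)]
      exact mul_le_of_le_one_right (hph x) (hi x).2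
  rw [← tendsto_sub_nhds_zero_iff] at hwp ⊢
  -- Since the weights lie in `[0, 1]`, replacing the empirical frequencies by `p` costs at most the
  -- `h`-weighted `ℓ¹` distance, whatever the weights.
  have hkey : Tendsto (fun i => (∑ m ∈ Finset.range (N i), w i (s m) * h (s m)) / N i -
      ∑' x, p x * h x * w i x) F (𝓝 0) := by
    refine squeeze_zero_norm' ?_ (hdist0.comp hN)
    filter_upwards [hw] with i hi
    have hs : Summable fun x => p x * h x * w i x := by
      refine .of_norm_bounded hsum fun x => ?_
      rw [Real.norm_of_nonneg (mul_nonneg (hph x) (hi x).1)]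
      exact mul_le_of_le_one_right (hph x) (hi x).2
    have h1 := (hasSum_empirical s (N i) fun x => w i x * h x).sub hs.hasSum
    rw [← h1.tsum_eq]
    refine tsum_of_norm_bounded (hdist (N i)).summable.hasSum fun x => ?_
    have : f (N i) x * (w i x * h x) - p x * h x * w i x = (f (N i) x - p x) * h x * w i x := by
      ring
    change ‖f (N i) x * (w i x * h x) - p x * h x * w i x‖ ≤ _
    rw [this, norm_mul, norm_mul, Real.norm_of_nonneg (hh x), Real.norm_of_nonneg (hi x).1,
      Real.norm_eq_abs]
    exact mul_le_of_le_one_right (mul_nonneg (abs_nonneg _) (hh x)) (hi x).2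
  simpa using hkey.add hwp

end Mean

/-- The probability function `∑_g π_g q(·; λ_g, ρ_g)` of a mixture of Laplace-like distributions. -/
noncomputable def mixtureProb {A : Type*} {k : ℕ} (d : StrDist A) (θ : MixParam A k) (s : Str A) :
    ℝ :=
  ∑ g, θ.weight g * laplaceLike d (θ.loc g) (θ.disp g) s

/-! ### Mixture probabilities and posterior weights -/

section Params

variable {A : Type*} {k : ℕ} {d : StrDist A} {θ : MixParam A k}

theorem weight_mul_laplaceLike_nonneg (hw : ∀ g, 0 ≤ θ.weight g) (hr : ∀ g, 0 ≤ θ.disp g)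
    (s : Str A) (g : Fin k) : 0 ≤ θ.weight g * laplaceLike d (θ.loc g) (θ.disp g) s :=
  mul_nonneg (hw g) (laplaceLike_nonneg (hr g) s)

theorem mixtureProb_nonneg (hw : ∀ g, 0 ≤ θ.weight g) (hr : ∀ g, 0 ≤ θ.disp g) (s : Str A) :
    0 ≤ mixtureProb d θ s :=
  Finset.sum_nonneg fun g _ => weight_mul_laplaceLike_nonneg hw hr s g

theorem posteriorWeight_mem_Icc (hw : ∀ g, 0 ≤ θ.weight g) (hr : ∀ g, 0 ≤ θ.disp g)
    (s : Str A) (g : Fin k) : 0 ≤ posteriorWeight d θ s g ∧ posteriorWeight d θ s g ≤ 1 :=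
  ⟨div_nonneg (weight_mul_laplaceLike_nonneg hw hr s g) (mixtureProb_nonneg hw hr s),
    div_le_one_of_le₀ (Finset.single_le_sum
      (fun g _ => weight_mul_laplaceLike_nonneg hw hr s g) (Finset.mem_univ g))
      (mixtureProb_nonneg hw hr s)⟩

/-- This survives a vanishing denominator, because then all its nonnegative summands vanish. -/
theorem mixtureProb_mul_posteriorWeight (hw : ∀ g, 0 ≤ θ.weight g) (hr : ∀ g, 0 ≤ θ.disp g)
    (s : Str A) (g : Fin k) : mixtureProb d θ s * posteriorWeight d θ s g =
      θ.weight g * laplaceLike d (θ.loc g) (θ.disp g) s := by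
  by_cases h : mixtureProb d θ s = 0
  · rw [h, zero_mul, (Finset.sum_eq_zero_iff_of_nonneg
      fun g _ => weight_mul_laplaceLike_nonneg hw hr s g).1 h g (Finset.mem_univ g)]
  · exact mul_div_cancel₀ _ h

theorem continuousAt_laplaceLike (l s : Str A) {ρ : ℝ} (hρ : 0 < ρ) :
    ContinuousAt (fun r => laplaceLike d l r s) ρ := by
  -- With the constant cardinality split off (it may be the default 0), `r + 1` is the only
  -- denominator to control.
  have : (fun r => laplaceLike d l r s) = fun r : ℝ =>
      1 / (r + 1) * (1 / ((strSphere d l (d.dist s l)).ncard : ℝ)) * (r / (r + 1)) ^ d.dist s l := by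
    funext r
    rw [laplaceLike, one_div_mul_one_div]
  rw [this]
  have h : ρ + 1 ≠ 0 := by positivity
  fun_prop (disch := exact h)

theorem tendsto_posteriorWeight {ι : Type*} {F : Filter ι} {θh : ι → MixParam A k} {s : Str A}
    (hr : ∀ g, 0 < θ.disp g) (hs : mixtureProb d θ s ≠ 0)
    (h1 : ∀ g, Tendsto (fun i => (θh i).weight g) F (𝓝 (θ.weight g)))
    (h2 : ∀ g, ∀ᶠ i in F, (θh i).loc g = θ.loc g)
    (h3 : ∀ g, Tendsto (fun i => (θh i).disp g) F (𝓝 (θ.disp g))) (g : Fin k) :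
    Tendsto (fun i => posteriorWeight d (θh i) s g) F (𝓝 (posteriorWeight d θ s g)) := by
  have h : ∀ g, Tendsto (fun i => (θh i).weight g * laplaceLike d ((θh i).loc g) ((θh i).disp g) s)
      F (𝓝 (θ.weight g * laplaceLike d (θ.loc g) (θ.disp g) s)) := by
    refine fun g => (h1 g).mul ?_
    refine ((continuousAt_laplaceLike (θ.loc g) s (hr g)).tendsto.comp (h3 g)).congr' ?_
    filter_upwards [h2 g] with i hi
    simp [hi]
  exact (h g).div (tendsto_finsetSum _ fun g _ => h g) hs

end Params

/-! ### The sampling model: laws, strong law of large numbers, true posterior -/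

namespace IsMixtureSample

variable {A Ω : Type*} [MeasurableSpace Ω] {k : ℕ} {P : Measure Ω} {d : StrDist A}
  {θ : MixParam A k} {σ : ℕ → Ω → Str A} {Z : ℕ → Ω → Fin k}

theorem measurableSet_preimage (h : IsMixtureSample P d θ σ Z) (i : ℕ) (U : Set (Str A × Fin k)) :
    MeasurableSet {ω | (σ i ω, Z i ω) ∈ U} :=
  h.measurable i (t := U) trivial

theorem real_string_eq [IsProbabilityMeasure P] (h : IsMixtureSample P d θ σ Z) (i : ℕ)
    (s : Str A) : P.real {ω | σ i ω = s} = mixtureProb d θ s := by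
  have hU : {ω | σ i ω = s} = ⋃ g, {ω | Z i ω = g ∧ σ i ω = s} := by
    ext ω
    simp
  rw [hU, measureReal_iUnion_fintype]
  · exact Finset.sum_congr rfl fun g _ => h.law i g s
  · intro g g' hg
    rw [Function.onFun, Set.disjoint_left]
    rintro ω ⟨h1, -⟩ ⟨h2, -⟩
    exact hg (h1.symm.trans h2)
  · exact fun g => h.measurableSet_preimage i {p | p.2 = g ∧ p.1 = s}

/-- For a general distance the formula need not define a probability (spheres may be infinite). The
normalization comes from the model instead: summing the joint law over the countably many strings
gives the law of the label. -/
theorem hasSum_laplaceLike [Finite A] [IsProbabilityMeasure P] (h : IsMixtureSample P d θ σ Z)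
    (g : Fin k) (hg : 0 < θ.weight g) :
    HasSum (laplaceLike d (θ.loc g) (θ.disp g)) 1 := by
  have hU : {ω | Z 0 ω = g} = ⋃ s, {ω | Z 0 ω = g ∧ σ 0 ω = s} := by
    ext ω
    simp
  have hP : P {ω | Z 0 ω = g} = ∑' s, P {ω | Z 0 ω = g ∧ σ 0 ω = s} := by
    conv_lhs => rw [hU]
    refine measure_iUnion ?_ fun s => h.measurableSet_preimage 0 {p | p.2 = g ∧ p.1 = s}
    intro s s' hs
    rw [Function.onFun, Set.disjoint_left]
    rintro ω ⟨-, h1⟩ ⟨-, h2⟩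
    exact hs (h1.symm.trans h2)
  have hsum := ENNReal.hasSum_toReal (hP ▸ measure_ne_top P _)
  rw [← ENNReal.tsum_toReal_eq fun s => measure_ne_top P _, ← hP] at hsum
  have hsum' : HasSum (fun s => θ.weight g * laplaceLike d (θ.loc g) (θ.disp g) s)
      (θ.weight g * 1) := by
    have hl : (P {ω | Z 0 ω = g}).toReal = θ.weight g := h.law_label 0 g
    rw [hl] at hsum
    rw [mul_one]
    exact hsum.congr_fun fun s => (h.law 0 g s).symm
  exact (hasSum_mul_left_iff hg.ne').1 hsum'

theorem sum_weight [IsProbabilityMeasure P] (h : IsMixtureSample P d θ σ Z) :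
    ∑ g, θ.weight g = 1 := by
  have hU : (Set.univ : Set Ω) = ⋃ g, {ω | Z 0 ω = g} := by
    ext ω
    simp
  have hP : P.real Set.univ = ∑ g, P.real {ω | Z 0 ω = g} := by
    rw [hU]
    refine measureReal_iUnion_fintype ?_ fun g => h.measurableSet_preimage 0 {p | p.2 = g}
    intro g g' hg
    rw [Function.onFun, Set.disjoint_left]
    intro ω h1 h2
    exact hg (h1.symm.trans h2)
  rw [probReal_univ] at hP
  rw [hP]
  exact Finset.sum_congr rfl fun g _ => (h.law_label 0 g).symm

theorem hasSum_mixtureProb [Finite A] [IsProbabilityMeasure P] (h : IsMixtureSample P d θ σ Z)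
    (hw : ∀ g, 0 < θ.weight g) : HasSum (mixtureProb d θ) 1 := by
  rw [← h.sum_weight]
  refine hasSum_sum fun g _ => ?_
  simpa using (h.hasSum_laplaceLike g (hw g)).mul_left (θ.weight g)

theorem ae_mixtureProb_ne_zero [Finite A] [IsProbabilityMeasure P]
    (h : IsMixtureSample P d θ σ Z) : ∀ᵐ ω ∂P, ∀ i, mixtureProb d θ (σ i ω) ≠ 0 := by
  have key : ∀ i s, mixtureProb d θ s = 0 → ∀ᵐ ω ∂P, σ i ω ≠ s := by
    intro i s hs
    rw [← h.real_string_eq i s, measureReal_eq_zero_iff] at hs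
    rw [ae_iff]
    simpa using hs
  have : ∀ᵐ ω ∂P, ∀ i s, mixtureProb d θ s = 0 → σ i ω ≠ s :=
    ae_all_iff.2 fun i => ae_all_iff.2 fun s => by
      by_cases hs : mixtureProb d θ s = 0
      · exact (key i s hs).mono fun ω hω _ => hω
      · exact Eventually.of_forall fun ω h' => absurd h' hs
  filter_upwards [this] with ω hω i hi
  exact hω i _ hi rfl

/-- The strong law of large numbers for functions of the strings of the sample. -/
theorem strongLaw [Finite A] [IsProbabilityMeasure P] (h : IsMixtureSample P d θ σ Z)
    (hw : ∀ g, 0 ≤ θ.weight g) (hr : ∀ g, 0 ≤ θ.disp g) {F : Str A → ℝ} (hF : ∀ s, 0 ≤ F s)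
    (hsum : Summable fun s => mixtureProb d θ s * F s) :
    ∀ᵐ ω ∂P, Tendsto (fun n : ℕ => (∑ i ∈ Finset.range n, F (σ i ω)) / n) atTop
      (𝓝 (∑' s, mixtureProb d θ s * F s)) := by
  -- There are countably many strings, so a law on the discrete σ-algebra is determined by
  -- singletons.
  let _ : MeasurableSpace (Str A) := ⊤
  have hσ : ∀ i, Measurable (σ i) := fun i U _ => h.measurableSet_preimage i {p | p.1 ∈ U}
  have hFm : Measurable F := measurable_from_top
  have hpF : ∀ s, 0 ≤ mixtureProb d θ s * F s := fun s =>
    mul_nonneg (mixtureProb_nonneg hw hr s) (hF s)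
  have hmap : ∀ i s, P.map (σ i) {s} = ENNReal.ofReal (mixtureProb d θ s) := by
    intro i s
    rw [Measure.map_apply (hσ i) (measurableSet_singleton s), ← h.real_string_eq i s,
      measureReal_def, ENNReal.ofReal_toReal (measure_ne_top _ _)]
    rfl
  have hident : ∀ i, IdentDistrib (fun ω => F (σ i ω)) (fun ω => F (σ 0 ω)) P P := fun i =>
    IdentDistrib.comp (f := σ i) (g := σ 0) ⟨(hσ i).aemeasurable, (hσ 0).aemeasurable,
      Measure.ext_iff_singleton.2 fun s => by rw [hmap, hmap]⟩ hFm
  have hlint : ∫⁻ ω, ENNReal.ofReal (F (σ 0 ω)) ∂P =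
      ENNReal.ofReal (∑' s, mixtureProb d θ s * F s) := by
    rw [← lintegral_map (f := fun s => ENNReal.ofReal (F s)) measurable_from_top (hσ 0),
      lintegral_countable', ENNReal.ofReal_tsum_of_nonneg hpF hsum]
    refine tsum_congr fun s => ?_
    rw [hmap, ← ENNReal.ofReal_mul (hF s), mul_comm]
  have hm : AEStronglyMeasurable (fun ω => F (σ 0 ω)) P :=
    (hFm.comp (hσ 0)).aestronglyMeasurable
  have hF0 : 0 ≤ᵐ[P] fun ω => F (σ 0 ω) := Eventually.of_forall fun ω => hF _
  have hint : Integrable (fun ω => F (σ 0 ω)) P :=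
    ⟨hm, (hasFiniteIntegral_iff_ofReal hF0).2 (hlint ▸ ENNReal.ofReal_lt_top)⟩
  have hindep : Pairwise (Function.onFun (fun X Y : Ω → ℝ => IndepFun X Y P)
      fun i ω => F (σ i ω)) := by
    intro i j hij
    have hm : @Measurable _ _ ⊤ _ fun p : Str A × Fin k => F p.1 := measurable_from_top
    exact (h.indep.indepFun hij).comp hm hm
  have := strong_law_ae_real (fun i ω => F (σ i ω)) hint hindep hident
  rwa [integral_eq_lintegral_of_nonneg_ae hF0 hm, hlint, ENNReal.toReal_ofReal (tsum_nonneg hpF)]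
    at this

open Classical in
theorem ae_tendsto_freq [Finite A] [IsProbabilityMeasure P] (h : IsMixtureSample P d θ σ Z)
    (hw : ∀ g, 0 ≤ θ.weight g) (hr : ∀ g, 0 ≤ θ.disp g) :
    ∀ᵐ ω ∂P, ∀ s, Tendsto
      (fun n : ℕ => (∑ i ∈ Finset.range n, if σ i ω = s then (1 : ℝ) else 0) / n) atTop
      (𝓝 (mixtureProb d θ s)) := by
  refine ae_all_iff.2 fun s => ?_
  have hs : HasSum (fun t => mixtureProb d θ t * if t = s then (1 : ℝ) else 0)
      (mixtureProb d θ s) := by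
    simpa using hasSum_single (f := fun t => mixtureProb d θ t * if t = s then (1 : ℝ) else 0) s
      fun t ht => by simp [ht]
  have := h.strongLaw hw hr (F := fun t => if t = s then 1 else 0)
    (fun t => by split_ifs <;> norm_num) hs.summable
  rwa [hs.tsum_eq] at this

/-- Given the strings of the sample, the label of the `i`-th string depends on this string only. -/
theorem truePosterior_eq [IsProbabilityMeasure P] (h : IsMixtureSample P d θ σ Z) {ω : Ω}
    (hω : ∀ i, mixtureProb d θ (σ i ω) ≠ 0) {n i : ℕ} (hi : i < n) (g : Fin k) :
    truePosterior P σ Z n i g ω = posteriorWeight d θ (σ i ω) g := by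
  -- Both the conditioning event and its intersection with the label event are product events that
  -- differ only in the factor `i`; all other factors cancel in the quotient.
  set U : ℕ → Set (Str A × Fin k) := fun j => {p | p.1 = σ j ω}
  set V : ℕ → Set (Str A × Fin k) := fun j => {p | p.1 = σ j ω ∧ (j = i → p.2 = g)}
  set E : Set Ω := {ω' | ∀ j < n, σ j ω' = σ j ω}
  have hE : E = ⋂ j ∈ Finset.range n, (fun ω' => (σ j ω', Z j ω')) ⁻¹' U j := by
    ext ω'
    simp [E, U]
  have hEg : E ∩ {ω' | Z i ω' = g} =
      ⋂ j ∈ Finset.range n, (fun ω' => (σ j ω', Z j ω')) ⁻¹' V j := by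
    ext ω'
    simp only [E, V, Set.mem_inter_iff, Set.mem_ofPred_eq, Set.mem_iInter, Finset.mem_range,
      Set.mem_preimage]
    constructor
    · rintro ⟨h1, h2⟩ j hj
      exact ⟨h1 j hj, fun hji => hji ▸ h2⟩
    · exact fun h' => ⟨fun j hj => (h' j hj).1, (h' i hi).2 rfl⟩
  have hEm : MeasurableSet E := by
    rw [hE]
    exact Finset.measurableSet_biInter _ fun j _ => h.measurableSet_preimage j (U j)
  have hU : P.real E = ∏ j ∈ Finset.range n, mixtureProb d θ (σ j ω) := by
    rw [measureReal_def, hE, h.indep.measure_inter_preimage_eq_mul _ fun _ _ => trivial,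
      ENNReal.toReal_prod]
    exact Finset.prod_congr rfl fun j _ => h.real_string_eq j _
  have hV : P.real (E ∩ {ω' | Z i ω' = g}) =
      (θ.weight g * laplaceLike d (θ.loc g) (θ.disp g) (σ i ω)) *
        ∏ j ∈ (Finset.range n).erase i, mixtureProb d θ (σ j ω) := by
    rw [measureReal_def, hEg, h.indep.measure_inter_preimage_eq_mul _ fun _ _ => trivial,
      ENNReal.toReal_prod, ← Finset.mul_prod_erase _ _ (Finset.mem_range.2 hi)]
    congr 1
    · rw [← h.law i g (σ i ω), measureReal_def]
      congr 2
      ext ω'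
      simp [V, and_comm]
    · refine Finset.prod_congr rfl fun j hj => ?_
      rw [← h.real_string_eq j (σ j ω), measureReal_def]
      congr 2
      ext ω'
      simp [V, Finset.ne_of_mem_erase hj]
  have hne : ∏ j ∈ (Finset.range n).erase i, mixtureProb d θ (σ j ω) ≠ 0 :=
    Finset.prod_ne_zero_iff.2 fun j _ => hω j
  rw [truePosterior, measureReal_def, cond_apply hEm, ENNReal.toReal_mul, ENNReal.toReal_inv,
    ← measureReal_def, ← measureReal_def, hU, hV,
    ← Finset.mul_prod_erase _ _ (Finset.mem_range.2 hi)]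
  change _ = _ / mixtureProb d θ (σ i ω)
  have := hω i
  field_simp

end IsMixtureSample

/-! ### Both directions of the theorem -/

section Consistency

variable {A Ω : Type*} [MeasurableSpace Ω] {k : ℕ} {P : Measure Ω} {θ : MixParam A k}
  {σ : ℕ → Ω → Str A} {Z : ℕ → Ω → Fin k}

/-- Needed because the posterior weights of step `t` are computed from the parameters of step `t -
1`. -/
theorem tendsto_fst_prod_sub_one :
    Tendsto (fun p : ℕ × ℕ => (p.1, p.2 - 1)) (atTop ×ˢ atTop) (atTop ×ˢ atTop) :=
  tendsto_fst.prodMk ((tendsto_sub_atTop_nat 1).comp tendsto_snd)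

theorem ae_tendsto_zetaHat_sub_truePosterior [Finite A] [IsProbabilityMeasure P] {d : StrDist A}
    (h : IsMixtureSample P d θ σ Z) (hr : ∀ g, 0 < θ.disp g) {θhat : ℕ → ℕ → Ω → MixParam A k}
    (h1 : ∀ g, ∀ᵐ ω ∂P, Tendsto (fun p : ℕ × ℕ => (θhat p.1 p.2 ω).weight g)
      (atTop ×ˢ atTop) (𝓝 (θ.weight g)))
    (h2 : ∀ g, ∀ᵐ ω ∂P, ∀ᶠ p : ℕ × ℕ in atTop ×ˢ atTop, (θhat p.1 p.2 ω).loc g = θ.loc g)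
    (h3 : ∀ g, ∀ᵐ ω ∂P, Tendsto (fun p : ℕ × ℕ => (θhat p.1 p.2 ω).disp g)
      (atTop ×ˢ atTop) (𝓝 (θ.disp g))) (i : ℕ) (g : Fin k) :
    ∀ᵐ ω ∂P, Tendsto (fun p : ℕ × ℕ => zetaHat d (fun t => θhat p.1 t ω) p.2 (σ i ω) g
      - truePosterior P σ Z p.1 i g ω) (atTop ×ˢ atTop) (𝓝 0) := by
  filter_upwards [h.ae_mixtureProb_ne_zero, ae_all_iff.2 h1, ae_all_iff.2 h2, ae_all_iff.2 h3]
    with ω hω h1 h2 h3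
  have hlim := (tendsto_posteriorWeight hr (hω i) h1 h2 h3 g).comp tendsto_fst_prod_sub_one
  have hsub := hlim.sub_const (posteriorWeight d θ (σ i ω) g)
  rw [sub_self] at hsub
  refine hsub.congr' ?_
  filter_upwards [tendsto_fst.eventually (eventually_gt_atTop i)] with p hp
  rw [h.truePosterior_eq hω hp]
  rfl

/-- The updates may leave `paramSpace`, for instance with dispersion 0. Nonnegativity is preserved
and suffices to keep the posterior weights in `[0, 1]`. -/
theorem IsAlgorithmHRun.weight_disp_nonneg {ε : ℝ} {n : ℕ} {s : ℕ → Str A}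
    {θs : ℕ → MixParam A k} (h : IsAlgorithmHRun ε n s θs) (t : ℕ) :
    (∀ g, 0 ≤ (θs t).weight g) ∧ ∀ g, 0 ≤ (θs t).disp g := by
  induction t with
  | zero => exact ⟨fun g => (h.init g).1.le, fun g => (h.init g).2.2.le⟩
  | succ t ih =>
    have hz : ∀ i g, 0 ≤ zetaHat (extHamming A) θs (t + 1) (s i) g := fun i g =>
      (posteriorWeight_mem_Icc ih.1 ih.2 (s i) g).1
    refine ⟨fun g => ?_, fun g => ?_⟩
    · rw [h.weight_step (t + 1) (by omega) g]
      exact mul_nonneg (by positivity) (Finset.sum_nonneg fun i _ => hz i g)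
    · rw [h.disp_step (t + 1) (by omega) g]
      exact mul_nonneg (one_div_nonneg.2 (Finset.sum_nonneg fun i _ => hz i g))
        (Finset.sum_nonneg fun i _ => mul_nonneg (hz i g) (Nat.cast_nonneg _))

theorem IsAlgorithmHRun.zetaHat_mem_Icc {ε : ℝ} {n : ℕ} {s : ℕ → Str A}
    {θs : ℕ → MixParam A k} (h : IsAlgorithmHRun ε n s θs) (t : ℕ) (x : Str A) (g : Fin k) :
    0 ≤ zetaHat (extHamming A) θs t x g ∧ zetaHat (extHamming A) θs t x g ≤ 1 :=
  posteriorWeight_mem_Icc (h.weight_disp_nonneg _).1 (h.weight_disp_nonneg _).2 x g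

/-- In each component, compare with the distance to its own centre by the triangle inequality. -/
theorem IsMixtureSample.summable_mixtureProb_mul_dist [Fintype A] [IsProbabilityMeasure P]
    (h : IsMixtureSample P (extHamming A) θ σ Z) (hθ : θ ∈ paramSpace A k)
    (hA : 2 ≤ Fintype.card A) (l : Str A) :
    Summable fun s => mixtureProb (extHamming A) θ s * ((extHamming A).dist s l : ℝ) := by
  simp only [mixtureProb, Finset.sum_mul]
  refine summable_sum fun g _ => ?_
  have hq := h.hasSum_laplaceLike g (hθ g).1
  have hd := hasSum_laplaceLike_mul_dist hA (θ.loc g) (hθ g).2.2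
  refine Summable.of_nonneg_of_le (fun s => ?_) (fun s => ?_)
    ((hd.summable.add (hq.summable.mul_right ((extHamming A).dist (θ.loc g) l : ℝ))).mul_left
      (θ.weight g))
  · exact mul_nonneg (mul_nonneg (hθ g).1.le (laplaceLike_nonneg (hθ g).2.2.le s))
      (Nat.cast_nonneg _)
  · have htri : ((extHamming A).dist s l : ℝ) ≤
        (extHamming A).dist s (θ.loc g) + (extHamming A).dist (θ.loc g) l := by
      exact_mod_cast (extHamming A).dist_triangle s (θ.loc g) l
    rw [mul_assoc, ← mul_add]
    exact mul_le_mul_of_nonneg_left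
      (mul_le_mul_of_nonneg_left htri (laplaceLike_nonneg (hθ g).2.2.le s)) (hθ g).1.le

/-- There are finitely many components and sites, each with a positive gap between the true letter
and another one. The bound depends on `θ` only. -/
theorem exists_siteProb_gap [Fintype A] (hθ : θ ∈ paramSpace A k) (hA : 2 ≤ Fintype.card A)
    (hq : ∀ g, Summable (laplaceLike (extHamming A) (θ.loc g) (θ.disp g))) :
    ∃ ε : ℝ, 0 < ε ∧ ∀ g, ∀ j < (θ.loc g).length, ∃ a b,
      ε < siteProb (laplaceLike (extHamming A) (θ.loc g) (θ.disp g)) j (some a) -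
        siteProb (laplaceLike (extHamming A) (θ.loc g) (θ.disp g)) j (some b) := by
  have key : ∀ᶠ ε : ℝ in 𝓝[>] 0, ∀ g, ∀ j ∈ {j | j < (θ.loc g).length}, ∃ a b,
      ε < siteProb (laplaceLike (extHamming A) (θ.loc g) (θ.disp g)) j (some a) -
        siteProb (laplaceLike (extHamming A) (θ.loc g) (θ.disp g)) j (some b) := by
    refine eventually_all.2 fun g => ?_
    rw [eventually_all_finite (Set.finite_lt_nat _)]
    intro j hj
    have : Nontrivial A := Fintype.one_lt_card_iff_nontrivial.1 (by omega)
    obtain ⟨b, hb⟩ := exists_ne (θ.loc g)[j]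
    have hlj : (θ.loc g)[j]? = some (θ.loc g)[j] := List.getElem?_eq_getElem hj
    have hlt := siteProb_lt_of_lt_length hA (hθ g).2.2 (hq g) hj (x := some b)
      (by rw [hlj]; simpa using hb)
    rw [hlj] at hlt
    filter_upwards [mem_nhdsWithin_of_mem_nhds (Iio_mem_nhds (sub_pos.2 hlt))] with ε hε
    exact ⟨_, b, hε⟩
  obtain ⟨ε, hε, hpos⟩ := (key.and self_mem_nhdsWithin).exists
  exact ⟨ε, hpos, hε⟩

/-- The exceptional null set comes only from the support of the mixture and the laws of large
numbers. Outside it the argument is deterministic, so `ε` and the run may be quantified after the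
outcome, which admits data-dependent choices. -/
theorem ae_tendsto_of_tendsto_zetaHat [Fintype A] [IsProbabilityMeasure P]
    (hθ : θ ∈ paramSpace A k) (hA : 2 ≤ Fintype.card A)
    (h : IsMixtureSample P (extHamming A) θ σ Z) {ε₀ : ℝ}
    (hε₀ : ∀ g, ∀ j < (θ.loc g).length, ∃ a b,
      ε₀ < siteProb (laplaceLike (extHamming A) (θ.loc g) (θ.disp g)) j (some a) -
        siteProb (laplaceLike (extHamming A) (θ.loc g) (θ.disp g)) j (some b)) :
    ∀ᵐ ω ∂P, ∀ ε, 0 < ε → ε ≤ ε₀ → ∀ θh : ℕ → ℕ → MixParam A k,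
      (∀ n, 1 ≤ n → IsAlgorithmHRun ε n (fun i => σ i ω) (θh n)) →
      (∀ (i : ℕ) (g : Fin k),
        Tendsto (fun p : ℕ × ℕ => zetaHat (extHamming A) (θh p.1) p.2 (σ i ω) g
          - truePosterior P σ Z p.1 i g ω) (atTop ×ˢ atTop) (𝓝 0)) →
      ∀ g : Fin k,
        Tendsto (fun p : ℕ × ℕ => (θh p.1 p.2).weight g) (atTop ×ˢ atTop) (𝓝 (θ.weight g)) ∧
        (∀ᶠ p : ℕ × ℕ in atTop ×ˢ atTop, (θh p.1 p.2).loc g = θ.loc g) ∧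
        Tendsto (fun p : ℕ × ℕ => (θh p.1 p.2).disp g) (atTop ×ˢ atTop) (𝓝 (θ.disp g)) := by
  classical
  have hw : ∀ g, 0 < θ.weight g := fun g => (hθ g).1
  have hw0 : ∀ g, 0 ≤ θ.weight g := fun g => (hw g).le
  have hr : ∀ g, 0 < θ.disp g := fun g => (hθ g).2.2
  have hr0 : ∀ g, 0 ≤ θ.disp g := fun g => (hr g).le
  have hsum1 : Summable fun s => mixtureProb (extHamming A) θ s * (1 : ℝ) := by
    simpa using (h.hasSum_mixtureProb hw).summable
  have hsumd := fun g => h.summable_mixtureProb_mul_dist hθ hA (θ.loc g)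
  filter_upwards [h.ae_mixtureProb_ne_zero, h.ae_tendsto_freq hw0 hr0,
    h.strongLaw hw0 hr0 (F := fun _ => 1) (fun _ => zero_le_one) hsum1,
    ae_all_iff.2 fun g => h.strongLaw hw0 hr0 (fun s => Nat.cast_nonneg _) (hsumd g)]
    with ω hne hfreq hone hdist ε hε hεε₀ θh hrun hζ g
  set q := laplaceLike (extHamming A) (θ.loc g) (θ.disp g) with hqdef
  have hq : HasSum q 1 := h.hasSum_laplaceLike g (hw g)
  set W : ℕ × ℕ → Str A → ℝ := fun p s => zetaHat (extHamming A) (θh p.1) p.2 s g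
  have hn : ∀ᶠ p : ℕ × ℕ in atTop ×ˢ atTop, 1 ≤ p.1 :=
    tendsto_fst.eventually (eventually_ge_atTop 1)
  have ht : ∀ᶠ p : ℕ × ℕ in atTop ×ˢ atTop, 1 ≤ p.2 :=
    tendsto_snd.eventually (eventually_ge_atTop 1)
  have hW01 : ∀ᶠ p : ℕ × ℕ in atTop ×ˢ atTop, ∀ s, 0 ≤ W p s ∧ W p s ≤ 1 :=
    hn.mono fun p hp s => (hrun p.1 hp).zetaHat_mem_Icc p.2 s g
  have hWlim : ∀ s, mixtureProb (extHamming A) θ s ≠ 0 →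
      Tendsto (fun p => W p s) (atTop ×ˢ atTop) (𝓝 (posteriorWeight (extHamming A) θ s g)) := by
    intro s hs
    -- A string that never occurs would have empirical frequency 0 in the limit.
    obtain ⟨i, rfl⟩ : ∃ i, σ i ω = s := by
      by_contra! hcon
      refine hs (tendsto_nhds_unique (hfreq s) ?_)
      simp [hcon]
    have h1 := (hζ i g).add_const (posteriorWeight (extHamming A) θ (σ i ω) g)
    rw [zero_add] at h1
    refine h1.congr' ?_
    filter_upwards [tendsto_fst.eventually (eventually_gt_atTop i)] with p hp
    rw [h.truePosterior_eq hne hp, sub_add_cancel]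
  -- `χ` is absorbed into the weights, so the law of large numbers is needed only for `f` and not
  -- for each indicator of a letter.
  have hmean : ∀ f χ : Str A → ℝ, (∀ s, 0 ≤ f s) → (∀ s, 0 ≤ χ s ∧ χ s ≤ 1) →
      Summable (fun s => mixtureProb (extHamming A) θ s * f s) →
      Tendsto (fun n : ℕ => (∑ i ∈ Finset.range n, f (σ i ω)) / n) atTop
        (𝓝 (∑' s, mixtureProb (extHamming A) θ s * f s)) →
      Tendsto (fun p : ℕ × ℕ =>
        (∑ m ∈ Finset.range p.1, W p (σ m ω) * χ (σ m ω) * f (σ m ω)) / p.1)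
        (atTop ×ˢ atTop) (𝓝 (θ.weight g * ∑' s, q s * (χ s * f s))) := by
    intro f χ hf hχ hfs hfm
    have hWχ01 : ∀ᶠ p : ℕ × ℕ in atTop ×ˢ atTop, ∀ s, 0 ≤ W p s * χ s ∧ W p s * χ s ≤ 1 := by
      filter_upwards [hW01] with p hp s
      exact ⟨mul_nonneg (hp s).1 (hχ s).1, mul_le_one₀ (hp s).2 (hχ s).1 (hχ s).2⟩
    have hWχ : ∀ s, mixtureProb (extHamming A) θ s ≠ 0 →
        Tendsto (fun p => W p s * χ s) (atTop ×ˢ atTop)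
          (𝓝 (posteriorWeight (extHamming A) θ s g * χ s)) :=
      fun s hs => (hWlim s hs).mul_const _
    have := tendsto_mean_mul_of_tendsto (mixtureProb_nonneg hw0 hr0) hf hfs hfreq hfm
      (tendsto_fst (f := atTop) (g := atTop)) hWχ01 hWχ
    rw [← tsum_mul_left, tsum_congr fun s => ?_]
    · exact this
    · rw [← mul_assoc (θ.weight g), hqdef, ← mixtureProb_mul_posteriorWeight hw0 hr0]
      ring
  have hmean1 := hmean (fun _ => 1) (fun _ => 1) (fun _ => zero_le_one)
    (fun _ => ⟨zero_le_one, le_rfl⟩) hsum1 hone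
  simp only [mul_one, hq.tsum_eq] at hmean1
  -- Normalizing by the total weight instead of `n` cancels the factor `π_g`.
  have hratio : ∀ {f : ℕ × ℕ → ℝ} {c : ℝ}, Tendsto (fun p => f p / p.1) (atTop ×ˢ atTop)
      (𝓝 (θ.weight g * c)) → Tendsto (fun p : ℕ × ℕ =>
        1 / (∑ m ∈ Finset.range p.1, W p (σ m ω)) * f p) (atTop ×ˢ atTop) (𝓝 c) := by
    intro f c hf
    have h1 := hf.div hmean1 (hw g).ne'
    rw [mul_div_cancel_left₀ _ (hw g).ne'] at h1
    refine h1.congr' ?_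
    filter_upwards [hn] with p hp
    have : (p.1 : ℝ) ≠ 0 := by positivity
    rw [Pi.div_apply, div_div_div_cancel_right₀ this, one_div_mul_eq_div]
  have hφ : ∀ j x, Tendsto (fun p : ℕ × ℕ =>
      weightedFreq p.1 (fun i => σ i ω) (fun i => W p (σ i ω)) j x) (atTop ×ˢ atTop)
      (𝓝 (siteProb q j x)) := by
    intro j x
    refine hratio ?_
    have := hmean (fun _ => 1) (fun s => if s[j]? = x then 1 else 0) (fun _ => zero_le_one)
      (fun s => by split_ifs <;> norm_num) hsum1 hone
    simp only [mul_one, mul_ite, mul_zero] at this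
    simp only [Finset.sum_filter]
    convert this using 3
    exact tsum_congr fun s => by simp [Set.indicator]
  have hloc : ∀ᶠ p : ℕ × ℕ in atTop ×ˢ atTop, (θh p.1 p.2).loc g = θ.loc g := by
    have : Nonempty A := Fintype.card_pos_iff.1 (by omega)
    refine eventually_eq_of_isTruncatedConsensus hε hφ
      (fun j hj x hx => siteProb_lt_of_lt_length hA (hr g) hq.summable hj hx)
      (fun j hj a b => siteProb_some_eq_of_length_le (hr g) hq.summable hj a b)
      (exists_siteProb_some_lt_none (laplaceLike_nonneg (hr0 g)) hq) ?_ ?_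
    · intro j hj
      obtain ⟨a, b, hab⟩ := hε₀ g j hj
      exact ⟨a, b, hεε₀.trans_lt hab⟩
    · filter_upwards [hn, ht] with p hp hp'
      exact (hrun p.1 hp).loc_step p.2 hp' g
  refine ⟨?_, hloc, ?_⟩
  · refine hmean1.congr' ?_
    filter_upwards [hn, ht] with p hp hp'
    rw [(hrun p.1 hp).weight_step p.2 hp' g, one_div_mul_eq_div]
  · have h1 := hmean _ (fun _ => 1) (fun s => Nat.cast_nonneg _)
      (fun _ => ⟨zero_le_one, le_rfl⟩) (hsumd g) (hdist g)
    simp only [mul_one, one_mul, hqdef,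
      (hasSum_laplaceLike_mul_dist hA (θ.loc g) (hr g)).tsum_eq] at h1
    refine (hratio h1).congr' ?_
    -- Once the location is exact, the distances to the estimate are distances to the fixed `λ_g`.
    filter_upwards [hn, ht, hloc] with p hp hp' hl
    rw [(hrun p.1 hp).disp_step p.2 hp' g, hl]

end Consistency

theorem mainTheorem5 {A : Type*} [Fintype A] {k : ℕ} {Ω : Type*} [MeasurableSpace Ω]
    (P : Measure Ω) [IsProbabilityMeasure P]
    (θ : MixParam A k) (hθ : θ ∈ paramSpace A k)
    (σ : ℕ → Ω → Str A) (Z : ℕ → Ω → Fin k) :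
    -- Part (a)
    (∀ d : StrDist A, IsMixtureSample P d θ σ Z →
      ∀ θhat : ℕ → ℕ → Ω → MixParam A k,
        (∀ g, ∀ᵐ ω ∂P, Tendsto (fun p : ℕ × ℕ => (θhat p.1 p.2 ω).weight g)
          (atTop ×ˢ atTop) (𝓝 (θ.weight g))) →
        (∀ g, ∀ᵐ ω ∂P, ∀ᶠ p : ℕ × ℕ in atTop ×ˢ atTop, (θhat p.1 p.2 ω).loc g = θ.loc g) →
        (∀ g, ∀ᵐ ω ∂P, Tendsto (fun p : ℕ × ℕ => (θhat p.1 p.2 ω).disp g)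
          (atTop ×ˢ atTop) (𝓝 (θ.disp g))) →
        ∀ (i : ℕ) (g : Fin k), ∀ᵐ ω ∂P,
          Tendsto (fun p : ℕ × ℕ => zetaHat d (fun t => θhat p.1 t ω) p.2 (σ i ω) g
            - truePosterior P σ Z p.1 i g ω) (atTop ×ˢ atTop) (𝓝 0)) ∧
    -- Part (b)
    (2 ≤ Fintype.card A → IsMixtureSample P (extHamming A) θ σ Z →
      ∃ ε₀ : ℝ, 0 < ε₀ ∧
        ∀ θhat : ℝ → ℕ → ℕ → Ω → MixParam A k,
          (∀ ε, 0 < ε → ∀ n, 1 ≤ n → ∀ ω,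
            IsAlgorithmHRun ε n (fun i => σ i ω) (fun t => θhat ε n t ω)) →
          ∀ᵐ ω ∂P, ∀ ε, 0 < ε → ε ≤ ε₀ →
            (∀ (i : ℕ) (g : Fin k),
              Tendsto (fun p : ℕ × ℕ =>
                zetaHat (extHamming A) (fun t => θhat ε p.1 t ω) p.2 (σ i ω) g
                  - truePosterior P σ Z p.1 i g ω) (atTop ×ˢ atTop) (𝓝 0)) →
            ∀ g : Fin k,
              Tendsto (fun p : ℕ × ℕ => (θhat ε p.1 p.2 ω).weight g)
                (atTop ×ˢ atTop) (𝓝 (θ.weight g)) ∧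
              (∀ᶠ p : ℕ × ℕ in atTop ×ˢ atTop, (θhat ε p.1 p.2 ω).loc g = θ.loc g) ∧
              Tendsto (fun p : ℕ × ℕ => (θhat ε p.1 p.2 ω).disp g)
                (atTop ×ˢ atTop) (𝓝 (θ.disp g))) := by
  refine ⟨fun d h θhat h1 h2 h3 i g =>
    ae_tendsto_zetaHat_sub_truePosterior h (fun g => (hθ g).2.2) h1 h2 h3 i g, fun hA h => ?_⟩
  obtain ⟨ε₀, hpos, hε₀⟩ := exists_siteProb_gap hθ hA
    fun g => (h.hasSum_laplaceLike g (hθ g).1).summable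
  refine ⟨ε₀, hpos, fun θhat hrun => ?_⟩
  filter_upwards [ae_tendsto_of_tendsto_zetaHat hθ hA h hε₀] with ω hω ε hε hle hζ
  exact hω ε hε hle (fun n t => θhat ε n t ω) (fun n hn => hrun ε hε n hn ω) hζ
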